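/- **Lemma 3.7.** Let $(M,\langle\cdot,\cdot\rangle,I)$ be an almost Hermitian manifold of real dimension $2n$: $M$ is a smooth manifold, $\langle\cdot,\cdot\rangle$ is a Riemannian metric, and $I$ is a smooth almost complex structure with $\langle IX,IY\rangle=\langle X,Y\rangle$. Let $\nabla$ be the Levi-Civita connection, let $\widetilde\nabla$ be the minimal $\mathrm U(n)$-connection and let $\xi=\widetilde\nabla-\nabla$ be the intrinsic torsion; that is, $\widetilde\nabla$ is the metric connection with $\widetilde\nabla I=0$ such that, for every $X$, the endomorphism $\xi_X=\widetilde\nabla_X-\nabla_X$ lies in the orthogonal complement of $\mathfrak u(n)$ in $\mathfrak{so}(2n)$. Put $$R_{X,Y}=\nabla_{[X,Y]}-[\nabla_X,\nabla_Y],\qquad \mathrm{Ric}^*(X,Y)=\sum_{i=1}^{2n}\langle R_{X,e_i}IY,Ie_i\rangle,$$ where $e_1,\dots,e_{2n}$ is an orthonormal basis of the tangent space, and let $$\mathrm{Ric}^*_{AH}(X,Y)=\tfrac12\bigl(\mathrm{Ric}^*(X,Y)-\mathrm{Ric}^*(IX,IY)\bigr)$$ be the anti-Hermitian part of $\mathrm{Ric}^*$.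 Let $I\xi$ be the tensor $(I\xi)_XY=I(\xi_XY)$. Then, at every point of $M$, for all tangent vectors $X,Y$ and every orthonormal basis $e_1,\dots,e_{2n}$ of the tangent space, $$\mathrm{Ric}^*_{AH}(X,Y)=\sum_{i=1}^{2n}\langle(\widetilde\nabla_{e_i}\xi)_{Ie_i}IX,Y\rangle-\sum_{i=1}^{2n}\langle\xi_{I\xi_{e_i}e_i}IX,Y\rangle=-\sum_{i=1}^{2n}\langle(\nabla_{e_i}I\xi)_{Ie_i}X,Y\rangle.$$ -/

import Mathlib

open Bundle Manifold
open scoped ContDiff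

noncomputable section

namespace AlmostHermitian

section

variable {E : Type*} [NormedAddCommGroup E] [NormedSpace ℝ E] [FiniteDimensional ℝ E]
  {M : Type*} [TopologicalSpace M] [ChartedSpace E M] [IsManifold 𝓘(ℝ, E) ∞ M]

/-! ### Metrics, almost complex structures and connections

`M` is a smooth manifold without boundary, with tangent space `TangentSpace 𝓘(ℝ, E) x` at `x`.
For a covariant derivative `D` on the tangent bundle, `D Y x u` is `(∇_u Y)(x)`. -/

/-- `J` is a smooth almost complex structure, orthogonal for the Riemannian metric `g`:
`(g, J)` is an almost Hermitian structure on `M`. -/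
structure IsAlmostHermitian
    (g : ContMDiffRiemannianMetric 𝓘(ℝ, E) ∞ E (fun x : M => TangentSpace 𝓘(ℝ, E) x))
    (J : ∀ x : M, TangentSpace 𝓘(ℝ, E) x →L[ℝ] TangentSpace 𝓘(ℝ, E) x) : Prop where
  smooth : ContMDiff 𝓘(ℝ, E) (𝓘(ℝ, E).prod 𝓘(ℝ, E →L[ℝ] E)) ∞
    (fun x => TotalSpace.mk' (E →L[ℝ] E)
      (E := fun x : M => TangentSpace 𝓘(ℝ, E) x →L[ℝ] TangentSpace 𝓘(ℝ, E) x) x (J x))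
  sq : ∀ (x : M) (u : TangentSpace 𝓘(ℝ, E) x), J x (J x u) = -u
  orthogonal : ∀ (x : M) (u v : TangentSpace 𝓘(ℝ, E) x),
    g.inner x (J x u) (J x v) = g.inner x u v

/-- The connection `D` is metric: `d⟨Y, Z⟩(u) = ⟨∇_u Y, Z⟩ + ⟨Y, ∇_u Z⟩`. -/
def IsMetric (g : ContMDiffRiemannianMetric 𝓘(ℝ, E) ∞ E (fun x : M => TangentSpace 𝓘(ℝ, E) x))
    (D : CovariantDerivative 𝓘(ℝ, E) E (TangentSpace 𝓘(ℝ, E) : M → Type _)) : Prop :=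
  ∀ (x : M) (Y Z : ∀ y : M, TangentSpace 𝓘(ℝ, E) y) (u : TangentSpace 𝓘(ℝ, E) x),
    MDiffAt (T% Y) x → MDiffAt (T% Z) x →
      d% (fun y => g.inner y (Y y) (Z y)) x u
        = g.inner x (D Y x u) (Z x) + g.inner x (Y x) (D Z x u)

/-- `D` is the Levi-Civita connection of `g`: the smooth, metric, torsion-free connection. -/
structure IsLeviCivita
    (g : ContMDiffRiemannianMetric 𝓘(ℝ, E) ∞ E (fun x : M => TangentSpace 𝓘(ℝ, E) x))
    (D : CovariantDerivative 𝓘(ℝ, E) E (TangentSpace 𝓘(ℝ, E) : M → Type _)) : Prop where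
  smooth : D.ContMDiffCovariantDerivative ∞
  metric : IsMetric g D
  torsion_free : haveI := FiniteDimensional.complete ℝ E; D.torsion = 0

/-- The difference tensor `ξ_X Y = ∇̃_X Y - ∇_X Y` of two connections `D = ∇` and `Dt = ∇̃`, as the
bilinear map `(X, Y) ↦ ξ_X Y`. -/
def differenceTensor (D Dt : CovariantDerivative 𝓘(ℝ, E) E (TangentSpace 𝓘(ℝ, E) : M → Type _))
    (x : M) : TangentSpace 𝓘(ℝ, E) x →ₗ[ℝ] TangentSpace 𝓘(ℝ, E) x →ₗ[ℝ] TangentSpace 𝓘(ℝ, E) x :=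
  ((ContinuousLinearMap.coeLM ℝ).comp (Dt.difference D x).toLinearMap).flip

/-- The Lie algebra `𝔰𝔬(T_x M)` of endomorphisms that are skew-symmetric for `g`. -/
def IsSkew (g : ContMDiffRiemannianMetric 𝓘(ℝ, E) ∞ E (fun x : M => TangentSpace 𝓘(ℝ, E) x))
    {x : M} (A : TangentSpace 𝓘(ℝ, E) x →ₗ[ℝ] TangentSpace 𝓘(ℝ, E) x) : Prop :=
  ∀ u v, g.inner x (A u) v = -g.inner x u (A v)

/-- `A` lies in the orthogonal complement of `𝔲(n)` in `𝔰𝔬(T_x M)`. Here `𝔲(n)` consists of the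
skew endomorphisms that commute with `J`, and `𝔰𝔬(T_x M)` has the inner product
`(A, B) ↦ -tr (A ∘ B)`. -/
def IsInUnitaryPerp
    (g : ContMDiffRiemannianMetric 𝓘(ℝ, E) ∞ E (fun x : M => TangentSpace 𝓘(ℝ, E) x))
    (J : ∀ x : M, TangentSpace 𝓘(ℝ, E) x →L[ℝ] TangentSpace 𝓘(ℝ, E) x)
    {x : M} (A : TangentSpace 𝓘(ℝ, E) x →ₗ[ℝ] TangentSpace 𝓘(ℝ, E) x) : Prop :=
  IsSkew g A ∧ ∀ B : TangentSpace 𝓘(ℝ, E) x →ₗ[ℝ] TangentSpace 𝓘(ℝ, E) x,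
    IsSkew g B → (∀ u, B (J x u) = J x (B u)) → LinearMap.trace ℝ _ (A ∘ₗ B) = 0

/-- `Dt` is the minimal `U(n)`-connection of the almost Hermitian structure `(g, J)` with Levi-Civita
connection `D`: the smooth connection `∇̃` that is metric, satisfies `∇̃ J = 0`, and whose
difference `ξ_X = ∇̃_X - ∇_X` takes values in the orthogonal complement of `𝔲(n)`. Then `ξ` is the
intrinsic torsion of the `U(n)`-structure. -/
structure IsMinimalUnitary
    (g : ContMDiffRiemannianMetric 𝓘(ℝ, E) ∞ E (fun x : M => TangentSpace 𝓘(ℝ, E) x))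
    (J : ∀ x : M, TangentSpace 𝓘(ℝ, E) x →L[ℝ] TangentSpace 𝓘(ℝ, E) x)
    (D Dt : CovariantDerivative 𝓘(ℝ, E) E (TangentSpace 𝓘(ℝ, E) : M → Type _)) : Prop where
  smooth : Dt.ContMDiffCovariantDerivative ∞
  metric : IsMetric g Dt
  parallel : ∀ (x : M) (Y : ∀ y : M, TangentSpace 𝓘(ℝ, E) y) (u : TangentSpace 𝓘(ℝ, E) x),
    MDiffAt (T% Y) x → Dt (fun y => J y (Y y)) x u = J x (Dt Y x u)
  perp : ∀ (x : M) (u : TangentSpace 𝓘(ℝ, E) x),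
    IsInUnitaryPerp g J (differenceTensor D Dt x u)

/-! ### Curvature and covariant derivatives of tensors

A tangent vector `u` at `x` is extended to the vector field `FiberBundle.extend E u`, which is smooth
near `x`. The expressions below are tensorial, so the choice of the extension is immaterial. -/

/-- The curvature operator `R_{X,Y} Z = ∇_{[X,Y]} Z - (∇_X ∇_Y Z - ∇_Y ∇_X Z)` of a connection
on vector fields. Note the sign convention. -/
def curvatureField (D : CovariantDerivative 𝓘(ℝ, E) E (TangentSpace 𝓘(ℝ, E) : M → Type _))
    (X Y Z : ∀ x : M, TangentSpace 𝓘(ℝ, E) x) (x : M) : TangentSpace 𝓘(ℝ, E) x :=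
  D Z x (VectorField.mlieBracket 𝓘(ℝ, E) X Y x)
    - (D (fun y => D Z y (Y y)) x (X x) - D (fun y => D Z y (X y)) x (Y x))

/-- The curvature tensor `R_{u,v} w` at the point `x`. -/
def curvature (D : CovariantDerivative 𝓘(ℝ, E) E (TangentSpace 𝓘(ℝ, E) : M → Type _))
    (x : M) (u v w : TangentSpace 𝓘(ℝ, E) x) : TangentSpace 𝓘(ℝ, E) x :=
  curvatureField D (FiberBundle.extend E u) (FiberBundle.extend E v) (FiberBundle.extend E w) x

/-- The covariant derivative of a tensor field `T`, `(X, Y) ↦ T_X Y`: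
`(∇_u T)_v w = ∇_u (T_V W) - T_{∇_u V} w - T_v (∇_u W)`, where the vector fields
`V`, `W` extend `v`, `w`. -/
def covDerivTensor (D : CovariantDerivative 𝓘(ℝ, E) E (TangentSpace 𝓘(ℝ, E) : M → Type _))
    (T : ∀ x : M, TangentSpace 𝓘(ℝ, E) x →ₗ[ℝ] TangentSpace 𝓘(ℝ, E) x →ₗ[ℝ]
      TangentSpace 𝓘(ℝ, E) x)
    (x : M) (u v w : TangentSpace 𝓘(ℝ, E) x) : TangentSpace 𝓘(ℝ, E) x :=
  D (fun y => T y (FiberBundle.extend E v y) (FiberBundle.extend E w y)) x u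
    - T x (D (FiberBundle.extend E v) x u) w
    - T x v (D (FiberBundle.extend E w) x u)

/-- The tensor field `J T`, `(J T)_X Y = J (T_X Y)`. -/
def compTensor (J : ∀ x : M, TangentSpace 𝓘(ℝ, E) x →L[ℝ] TangentSpace 𝓘(ℝ, E) x)
    (T : ∀ x : M, TangentSpace 𝓘(ℝ, E) x →ₗ[ℝ] TangentSpace 𝓘(ℝ, E) x →ₗ[ℝ]
      TangentSpace 𝓘(ℝ, E) x)
    (x : M) : TangentSpace 𝓘(ℝ, E) x →ₗ[ℝ] TangentSpace 𝓘(ℝ, E) x →ₗ[ℝ]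
      TangentSpace 𝓘(ℝ, E) x :=
  (T x).compr₂ (J x).toLinearMap

/-! ### The `*`-Ricci curvature -/

/-- `e` is an orthonormal basis of `T_x M`. -/
def IsOrthonormalBasis
    (g : ContMDiffRiemannianMetric 𝓘(ℝ, E) ∞ E (fun x : M => TangentSpace 𝓘(ℝ, E) x))
    {x : M} {m : ℕ} (e : Module.Basis (Fin m) ℝ (TangentSpace 𝓘(ℝ, E) x)) : Prop :=
  ∀ i j, g.inner x (e i) (e j) = if i = j then 1 else 0

/-- The `*`-Ricci curvature `Ric*(u, v) = ∑ i, ⟨R_{u, e_i} J v, J e_i⟩`, computed in the basis `e` of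
`T_x M` and with the connection `D`. It does not depend on the choice of the orthonormal
basis `e`. -/
def starRicci (g : ContMDiffRiemannianMetric 𝓘(ℝ, E) ∞ E (fun x : M => TangentSpace 𝓘(ℝ, E) x))
    (J : ∀ x : M, TangentSpace 𝓘(ℝ, E) x →L[ℝ] TangentSpace 𝓘(ℝ, E) x)
    (D : CovariantDerivative 𝓘(ℝ, E) E (TangentSpace 𝓘(ℝ, E) : M → Type _))
    {x : M} {m : ℕ} (e : Module.Basis (Fin m) ℝ (TangentSpace 𝓘(ℝ, E) x))
    (u v : TangentSpace 𝓘(ℝ, E) x) : ℝ :=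
  ∑ i, g.inner x (curvature D x u (e i) (J x v)) (J x (e i))

/-- The anti-Hermitian part `b_AH(u, v) = (b(u, v) - b(J u, J v)) / 2` of a bilinear form `b` on
`T_x M`, that is, its component with `b_AH(J u, J v) = -b_AH(u, v)`. -/
def antiHermitianPart (J : ∀ x : M, TangentSpace 𝓘(ℝ, E) x →L[ℝ] TangentSpace 𝓘(ℝ, E) x)
    {x : M} (b : TangentSpace 𝓘(ℝ, E) x → TangentSpace 𝓘(ℝ, E) x → ℝ)
    (u v : TangentSpace 𝓘(ℝ, E) x) : ℝ :=
  (b u v - b (J x u) (J x v)) / 2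

end

end AlmostHermitian

end

open AlmostHermitian

open Bundle Manifold
open scoped ContDiff
open AlmostHermitian

namespace AlmostHermitian

/-! ### Linear algebra at a single point. -/

section LinearAlgebra

variable {V : Type*} [AddCommGroup V] [Module ℝ V]

/-! The first Bianchi identity turns `2 Ric*(X, Y)` into the trace `∑ ⟨R_{e_i, J e_i} X, J Y⟩`, in
which `R` acts on `X` directly. Substituting `∇ = ∇̃ - ξ` splits `R` into the curvature of `∇̃`, the
alternated `∇̃ξ`, the commutator of `ξ` with itself, and terms `ξ_{ξ_X Y}`. The curvature of `∇̃`
commutes with `J` since `∇̃ J = 0`. Orthogonality to `𝔲(n)` makes each `ξ_X` anticommute with `J`,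
so products of two of them commute with `J`. The anti-Hermitian part kills everything that commutes
with `J`, leaving only `∇̃ξ` and `ξ_ξ` (`half_sub_starRicci`). For the second equality, `∇(Jξ)` is
expanded through `∇̃`; the extra terms symmetric in `e_i` and `J e_i` vanish in the trace because
`J` is skew (`sum_deriv_complex_torsion`).

The differential geometry only has to supply `TorsionCurvatureData` at a point. Values are extended
linearly to global smooth fields, where the curvature identities become formal identities between
`ℝ`-bilinear maps. -/

lemma sum_orthonormal_smul {m : ℕ} {g : V →ₗ[ℝ] V →ₗ[ℝ] ℝ} {e : Module.Basis (Fin m) ℝ V}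
    (he : ∀ i j, g (e i) (e j) = if i = j then 1 else 0) (v : V) :
    ∑ j, g v (e j) • e j = v := by
  have h : ∀ j, g v (e j) = e.repr v j := fun j => by
    conv_lhs => rw [← e.sum_repr v]
    simp only [map_sum, map_smul, LinearMap.sum_apply, LinearMap.smul_apply, he, smul_eq_mul,
      mul_ite, mul_one, mul_zero, Finset.sum_ite_eq', Finset.mem_univ, if_true]
  simp only [h, e.sum_repr]

/-- The matrix of `A` in an orthonormal basis is antisymmetric, so exchanging the two summation
indices changes the sign. With `A = J` this kills the trace of any symmetric `b` against `J`. -/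
lemma sum_apply_skew {m : ℕ} {g : V →ₗ[ℝ] V →ₗ[ℝ] ℝ} {e : Module.Basis (Fin m) ℝ V}
    (he : ∀ i j, g (e i) (e j) = if i = j then 1 else 0) (hg : ∀ u v, g u v = g v u)
    {A : V →ₗ[ℝ] V} (hA : ∀ u v, g (A u) v = -g u (A v)) (b : V →ₗ[ℝ] V →ₗ[ℝ] ℝ) :
    ∑ i, b (A (e i)) (e i) = -∑ i, b (e i) (A (e i)) := by
  have h1 : ∀ i, b (A (e i)) (e i) = ∑ j, g (A (e i)) (e j) * b (e j) (e i) := fun i => by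
    conv_lhs => rw [← sum_orthonormal_smul he (A (e i))]
    simp
  have h2 : ∀ i, b (e i) (A (e i)) = ∑ j, g (A (e i)) (e j) * b (e i) (e j) := fun i => by
    conv_lhs => rw [← sum_orthonormal_smul he (A (e i))]
    simp
  simp only [h1, h2, ← Finset.sum_neg_distrib]
  rw [Finset.sum_comm]
  refine Finset.sum_congr rfl fun i _ => Finset.sum_congr rfl fun j _ => ?_
  rw [hA, hg (e j)]
  ring

/-- The algebraic relations at one point between the curvature `R` of the Levi-Civita connection,
the curvature `K` of the minimal connection, the intrinsic torsion `ξ` and its covariant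
derivative `C` for the minimal connection. -/
structure TorsionCurvatureData (g : V →ₗ[ℝ] V →ₗ[ℝ] ℝ) (J : V →ₗ[ℝ] V)
    (R K C : V →ₗ[ℝ] V →ₗ[ℝ] V →ₗ[ℝ] V) (ξ : V →ₗ[ℝ] V →ₗ[ℝ] V) : Prop where
  symm : ∀ u v, g u v = g v u
  sq : ∀ u, J (J u) = -u
  orthogonal : ∀ u v, g (J u) (J v) = g u v
  curvature_swap : ∀ u v w, R v u w = -R u v w
  curvature_skew : ∀ u v w z, g (R u v w) z = -g w (R u v z)
  bianchi : ∀ u v w, R u v w + R v w u + R w u v = 0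
  curvature_eq : ∀ u v w, R u v w = K u v w + C u v w - C v u w - ξ u (ξ v w) + ξ v (ξ u w)
    + ξ (ξ u v) w - ξ (ξ v u) w
  curvature_comm : ∀ u v w, K u v (J w) = J (K u v w)
  deriv_anticomm : ∀ u v w, C u v (J w) = -J (C u v w)
  torsion_anticomm : ∀ u v, ξ u (J v) = -J (ξ u v)

namespace TorsionCurvatureData

variable {g : V →ₗ[ℝ] V →ₗ[ℝ] ℝ} {J : V →ₗ[ℝ] V} {R K C : V →ₗ[ℝ] V →ₗ[ℝ] V →ₗ[ℝ] V}
  {ξ : V →ₗ[ℝ] V →ₗ[ℝ] V} (h : TorsionCurvatureData g J R K C ξ)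
  {m : ℕ} {e : Module.Basis (Fin m) ℝ V}

include h

lemma complex_skew (u v : V) : g (J u) v = -g u (J v) := by
  rw [← h.orthogonal u (J v), h.sq, map_neg, neg_neg]

/-- Bianchi gives `R_{e, Je} u = R_{u, Je} e - R_{u, e} Je`. By skewness of `J` and of `R`, each of
the two terms contributes one copy of the left-hand sum. -/
lemma two_mul_starRicci (he : ∀ i j, g (e i) (e j) = if i = j then 1 else 0) (u v : V) :
    2 * ∑ i, g (R u (e i) (J v)) (J (e i)) = ∑ i, g (R (e i) (J (e i)) u) (J v) := by
  have key : ∀ i, g (R (e i) (J (e i)) u) (J v)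
      = g (R u (J (e i)) (e i)) (J v) + g (R u (e i) (J v)) (J (e i)) := fun i => by
    have hb := h.bianchi (e i) (J (e i)) u
    rw [h.curvature_swap u (J (e i))] at hb
    have h' : R (e i) (J (e i)) u = R u (J (e i)) (e i) - R u (e i) (J (e i)) := by
      rw [← sub_eq_zero, ← hb]; abel
    rw [h', map_sub, LinearMap.sub_apply, h.curvature_skew u (e i), h.symm (J (e i))]
    ring
  have hs := sum_apply_skew he h.symm h.complex_skew ((R u).compr₂ (g.flip (J v)))
  simp only [LinearMap.compr₂_apply, LinearMap.flip_apply] at hs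
  simp only [key, Finset.sum_add_distrib, hs]
  rw [← Finset.sum_neg_distrib, two_mul]
  congr 1
  exact Finset.sum_congr rfl fun i _ => by rw [h.curvature_skew, h.symm (R _ _ _)]

/-- A part of `R` that commutes with `J` cancels in the difference; a part that anticommutes is
doubled. -/
lemma half_sub_starRicci (he : ∀ i j, g (e i) (e j) = if i = j then 1 else 0) (u v : V) :
    (∑ i, g (R u (e i) (J v)) (J (e i)) - ∑ i, g (R (J u) (e i) (J (J v))) (J (e i))) / 2
      = ∑ i, g (C (e i) (J (e i)) (J u)) v - ∑ i, g (ξ (J (ξ (e i) (e i))) (J u)) v := by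
  have h1 := h.two_mul_starRicci he u v
  have h2 := h.two_mul_starRicci he (J u) (J v)
  have key : ∀ i, g (R (e i) (J (e i)) u) (J v) - g (R (e i) (J (e i)) (J u)) (J (J v))
      = 2 * (g (C (e i) (J (e i)) (J u)) v - g (C (J (e i)) (e i) (J u)) v
        - g (ξ (J (ξ (e i) (e i))) (J u)) v - g (ξ (ξ (J (e i)) (e i)) (J u)) v) := fun i => by
    simp only [h.curvature_eq, h.curvature_comm, h.deriv_anticomm, h.torsion_anticomm, h.sq,
      map_add, map_sub, map_neg, LinearMap.add_apply, LinearMap.sub_apply, LinearMap.neg_apply,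
      h.complex_skew]
    ring
  have hC := sum_apply_skew he h.symm h.complex_skew
    (LinearMap.mk₂ ℝ (fun a b => g (C a b (J u)) v) (by simp) (by simp) (by simp) (by simp))
  have hξ := sum_apply_skew he h.symm h.complex_skew
    (LinearMap.mk₂ ℝ (fun a b => g (ξ (ξ a b) (J u)) v) (by simp) (by simp) (by simp) (by simp))
  simp only [LinearMap.mk₂_apply] at hC hξ
  -- The arguments are fixed so that only the inner `ξ_e (J e)` is rewritten and the outer `J u`
  -- survives.
  simp only [h.torsion_anticomm (e _) (e _), map_neg, LinearMap.neg_apply,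
    Finset.sum_neg_distrib, neg_neg] at hξ
  have h3 := Finset.sum_congr (rfl : (Finset.univ : Finset (Fin m)) = _) fun i _ => key i
  simp only [← Finset.mul_sum, Finset.sum_sub_distrib] at h3
  linarith

/-- Moving `J` to the left turns two quadratic terms into `J (ξ_a ξ_b + ξ_b ξ_a)` with `a = e_i`, `b
= J e_i`, which is symmetric and so has zero trace against `J`. -/
lemma sum_deriv_complex_torsion (he : ∀ i j, g (e i) (e j) = if i = j then 1 else 0) (u v : V) :
    ∑ i, g (C (e i) (J (e i)) (J u)) v - ∑ i, g (ξ (J (ξ (e i) (e i))) (J u)) v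
      = -∑ i, g (J (C (e i) (J (e i)) u) - ξ (e i) (J (ξ (J (e i)) u))
        + J (ξ (ξ (e i) (J (e i))) u) + J (ξ (J (e i)) (ξ (e i) u))) v := by
  have hξ := sum_apply_skew he h.symm h.complex_skew
    (LinearMap.mk₂ ℝ (fun a b => g (J (ξ a (ξ b u))) v) (by simp) (by simp) (by simp) (by simp))
  simp only [LinearMap.mk₂_apply] at hξ
  simp only [h.deriv_anticomm, h.torsion_anticomm, map_add, map_sub, map_neg,
    LinearMap.add_apply, LinearMap.sub_apply, LinearMap.neg_apply, Finset.sum_add_distrib,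
    Finset.sum_sub_distrib, Finset.sum_neg_distrib, hξ]
  ring

end TorsionCurvatureData

/-- A skew endomorphism that is trace-orthogonal to the skew endomorphisms commuting with `J`
anticommutes with `J`. -/
lemma apply_complex_eq_neg_of_trace [FiniteDimensional ℝ V] {g : V →ₗ[ℝ] V →ₗ[ℝ] ℝ}
    {J A : V →ₗ[ℝ] V} (hg : ∀ u v, g u v = g v u) (hpos : ∀ u, u ≠ 0 → 0 < g u u)
    (hsq : ∀ u, J (J u) = -u) (hJ : ∀ u v, g (J u) v = -g u (J v))
    (hA : ∀ u v, g (A u) v = -g u (A v))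
    (htr : ∀ B : V →ₗ[ℝ] V, (∀ u v, g (B u) v = -g u (B v)) → (∀ u, B (J u) = J (B u)) →
      LinearMap.trace ℝ V (A ∘ₗ B) = 0) (u : V) :
    A (J u) = -J (A u) := by
  have hJJ : J * J = -1 := LinearMap.ext fun u => by simp [hsq]
  -- `B` is twice the component of `A` commuting with `J`; it will be shown to vanish because `tr B²
  -- = 0` and `B` is skew.
  set B : V →ₗ[ℝ] V := A - J * A * J with hB
  have hBs : ∀ u v, g (B u) v = -g u (B v) := fun u v => by
    simp only [hB, LinearMap.sub_apply, Module.End.mul_apply, map_sub, hJ, hA]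
    ring
  have hBJ : B * J = J * B := by
    rw [hB, sub_mul, mul_sub, mul_assoc (J * A), ← mul_assoc J (J * A), ← mul_assoc J J, hJJ]
    simp only [mul_neg, neg_mul, mul_one, one_mul]
    abel
  have h0 : LinearMap.trace ℝ V (A * B) = 0 :=
    htr B hBs fun u => by simpa using LinearMap.congr_fun hBJ u
  have h1 : LinearMap.trace ℝ V (J * A * J * B) = 0 := by
    rw [mul_assoc, ← hBJ, mul_assoc J, LinearMap.trace_mul_comm, mul_assoc, mul_assoc, hJJ]
    simp [h0]
  have h2 : LinearMap.trace ℝ V (B * B) = 0 := by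
    conv_lhs => rw [show B * B = A * B - J * A * J * B by rw [hB, sub_mul]]
    rw [map_sub, h0, h1, sub_zero]
  -- In an orthogonal basis the diagonal entries of `B²` are `-g(B b_i, B b_i) / g(b_i, b_i)`, hence
  -- nonpositive.
  obtain ⟨b, hb⟩ := LinearMap.BilinForm.exists_orthogonal_basis (B := g) ⟨fun u v => hg u v⟩
  have hc : ∀ i w, g w (b i) = b.repr w i * g (b i) (b i) := fun i w => by
    conv_lhs => rw [← b.sum_repr w]
    rw [map_sum, LinearMap.sum_apply, Finset.sum_eq_single i]
    · simp
    · intro j _ hj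
      rw [map_smul, LinearMap.smul_apply, hb hj, smul_zero]
    · simp
  have hle : ∀ i, b.repr (B (B (b i))) i ≤ 0 ∧ (b.repr (B (B (b i))) i = 0 → B (b i) = 0) := by
    intro i
    have hp := hpos _ (b.ne_zero i)
    have hi := hc i (B (B (b i)))
    rw [hBs] at hi
    by_cases hz : B (b i) = 0
    · simp [hz]
    · have := hpos _ hz
      have : b.repr (B (B (b i))) i < 0 := by
        by_contra hcon
        nlinarith
      exact ⟨this.le, fun h => absurd h this.ne⟩
  have hsum : ∑ i, b.repr (B (B (b i))) i = 0 := by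
    rw [← h2, LinearMap.trace_eq_matrix_trace ℝ b]
    simp [Matrix.trace, LinearMap.toMatrix_apply]
  have hB0 : B = 0 := b.ext fun i =>
    (hle i).2 ((Finset.sum_eq_zero_iff_of_nonpos fun i _ => (hle i).1).1 hsum i (Finset.mem_univ _))
  have h3 := LinearMap.congr_fun (sub_eq_zero.1 (hB.symm.trans hB0)) (J u)
  simp only [Module.End.mul_apply, hsq, map_neg] at h3
  rw [h3]

end LinearAlgebra
end AlmostHermitian

namespace AlmostHermitian

/-! ### Smooth vector fields and extension of tangent vectors. -/

noncomputable section Geometry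

variable {E : Type*} [NormedAddCommGroup E] [NormedSpace ℝ E]
  {M : Type*} [TopologicalSpace M] [ChartedSpace E M]

variable (E M) in
/-- The smooth vector fields on `M`. -/
abbrev SmoothField [IsManifold 𝓘(ℝ, E) ∞ M] : Type _ :=
  ContMDiffSection 𝓘(ℝ, E) E ∞ (TangentSpace 𝓘(ℝ, E) : M → Type _)

variable [IsManifold 𝓘(ℝ, E) ∞ M]

/-- The value of a vector field at a point. -/
def SmoothField.eval (x : M) : SmoothField E M →ₗ[ℝ] TangentSpace 𝓘(ℝ, E) x where
  toFun U := U x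
  map_add' _ _ := rfl
  map_smul' _ _ := rfl

@[simp] lemma SmoothField.eval_apply (x : M) (U : SmoothField E M) :
    SmoothField.eval x U = U x := rfl

/-- The vector field that is constant in the preferred trivialization at `x`, and zero outside its
domain. It depends linearly on its value at `x`. -/
def localConstField (x : M) (y : M) :
    TangentSpace 𝓘(ℝ, E) x →ₗ[ℝ] TangentSpace 𝓘(ℝ, E) y :=
  (trivializationAt E (TangentSpace 𝓘(ℝ, E) : M → Type _) x).symmₗ ℝ y ∘ₗ
    (trivializationAt E (TangentSpace 𝓘(ℝ, E) : M → Type _) x).linearMapAt ℝ x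

lemma localConstField_eq_extend {x : M} (u : TangentSpace 𝓘(ℝ, E) x) {y : M}
    (hy : y ∈ (trivializationAt E (TangentSpace 𝓘(ℝ, E) : M → Type _) x).baseSet) :
    localConstField x y u = FiberBundle.extend E u y := by
  have hx := FiberBundle.mem_baseSet_trivializationAt' (F := E)
    (E := (TangentSpace 𝓘(ℝ, E) : M → Type _)) x
  rw [localConstField, LinearMap.comp_apply, Trivialization.linearMapAt_apply, if_pos hx,
    Trivialization.symmₗ_apply _ hy]
  rfl

lemma contMDiffOn_localConstField {x : M} (u : TangentSpace 𝓘(ℝ, E) x) :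
    CMDiff[(trivializationAt E (TangentSpace 𝓘(ℝ, E) : M → Type _) x).baseSet] ∞
      (T% (fun y => localConstField x y u)) := by
  intro y hy
  rw [(trivializationAt E (TangentSpace 𝓘(ℝ, E) : M → Type _) x).contMDiffWithinAt_section _ hy]
  refine (contMDiffOn_const (c :=
    (trivializationAt E (TangentSpace 𝓘(ℝ, E) : M → Type _) x ⟨x, u⟩).2)).congr
    (fun z hz => ?_) y hy
  rw [localConstField_eq_extend u hz, FiberBundle.extend, Trivialization.apply_mk_symm _ hz]

/-- The action of a smooth connection on smooth vector fields, `(U, W) ↦ ∇_U W`. -/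
def connectionMap (D : CovariantDerivative 𝓘(ℝ, E) E (TangentSpace 𝓘(ℝ, E) : M → Type _))
    (hD : D.ContMDiffCovariantDerivative ∞) :
    SmoothField E M →ₗ[ℝ] SmoothField E M →ₗ[ℝ] SmoothField E M :=
  LinearMap.mk₂ ℝ (fun U W => ⟨fun y => D W y (U y), by
    have h := hD.contMDiff.contMDiff (σ := W) W.contMDiff.contMDiffOn
    exact (contMDiffOn_univ.1 h).clm_bundle_apply U.contMDiff⟩)
    (fun U V W => by ext y; exact (D W y).map_add _ _)
    (fun c U W => by ext y; exact (D W y).map_smul _ _)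
    (fun U V W => by
      ext y
      exact congrArg (fun A => A (U y))
        (D.isCovariantDerivativeOn.add (s := Set.univ) V.mdifferentiableAt W.mdifferentiableAt))
    (fun c U W => by
      ext y
      exact congrArg (fun A => A (U y))
        (D.isCovariantDerivativeOn.smul_const (s := Set.univ) c W.mdifferentiableAt))

@[simp] lemma connectionMap_apply
    (D : CovariantDerivative 𝓘(ℝ, E) E (TangentSpace 𝓘(ℝ, E) : M → Type _))
    (hD : D.ContMDiffCovariantDerivative ∞) (U W : SmoothField E M) (y : M) :
    connectionMap D hD U W y = D W y (U y) := rfl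

variable [FiniteDimensional ℝ E]

lemma minSmoothness_two_le_infty : minSmoothness ℝ 2 ≤ ∞ := by
  rw [minSmoothness_of_isRCLikeNormedField]
  exact (show ((2 : ℕ∞) : ℕ∞ω) ≤ ∞ from mod_cast le_top)

lemma minSmoothness_three_le_infty : minSmoothness ℝ 3 ≤ ∞ := by
  rw [minSmoothness_of_isRCLikeNormedField]
  exact (show ((3 : ℕ∞) : ℕ∞ω) ≤ ∞ from mod_cast le_top)

/-- The Lie bracket of smooth vector fields. -/
def bracketMap : SmoothField E M →ₗ[ℝ] SmoothField E M →ₗ[ℝ] SmoothField E M :=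
  haveI := FiniteDimensional.complete ℝ E
  haveI : IsManifold 𝓘(ℝ, E) (minSmoothness ℝ 2) M := .of_le minSmoothness_two_le_infty
  haveI : IsManifold 𝓘(ℝ, E) (((⊤ : ℕ∞) : ℕ∞ω) + 1) M := .of_le (n := ∞) le_rfl
  LinearMap.mk₂ ℝ (fun U W => ⟨VectorField.mlieBracket 𝓘(ℝ, E) U W, by
    exact ContDiff.mlieBracket_vectorField (m := ⊤) (n := ⊤) U.contMDiff W.contMDiff (by simp)⟩)
    (fun U V W => by
      ext y; exact VectorField.mlieBracket_add_left U.mdifferentiableAt V.mdifferentiableAt)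
    (fun c U W => by ext y; exact VectorField.mlieBracket_const_smul_left U.mdifferentiableAt)
    (fun U V W => by
      ext y; exact VectorField.mlieBracket_add_right V.mdifferentiableAt W.mdifferentiableAt)
    (fun c U W => by ext y; exact VectorField.mlieBracket_const_smul_right W.mdifferentiableAt)

@[simp] lemma bracketMap_apply (U W : SmoothField E M) (y : M) :
    bracketMap U W y = VectorField.mlieBracket 𝓘(ℝ, E) U W y := rfl

lemma bracketMap_swap (U V : SmoothField E M) : bracketMap V U = -bracketMap U V := by
  ext y; exact VectorField.mlieBracket_swap_apply

lemma bracketMap_jacobi (U V W : SmoothField E M) :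
    bracketMap U (bracketMap V W)
      = bracketMap (bracketMap U V) W + bracketMap V (bracketMap U W) := by
  have := FiniteDimensional.complete ℝ E
  have : IsManifold 𝓘(ℝ, E) (minSmoothness ℝ 3) M := .of_le (n := ∞) minSmoothness_three_le_infty
  ext y
  exact VectorField.leibniz_identity_mlieBracket_apply
    (U.contMDiff.contMDiffAt.of_le minSmoothness_two_le_infty)
    (V.contMDiff.contMDiffAt.of_le minSmoothness_two_le_infty)
    (W.contMDiff.contMDiffAt.of_le minSmoothness_two_le_infty)

/-- A smooth bump function centered at `x`. -/
def bumpAt (x : M) : SmoothBumpFunction 𝓘(ℝ, E) x :=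
  Classical.choice inferInstance

variable [T2Space M]

variable (E) in
/-- A smooth vector field with prescribed value at `x`, depending linearly on the value. -/
def extendField (x : M) : TangentSpace 𝓘(ℝ, E) x →ₗ[ℝ] SmoothField E M where
  -- The support of the bump function lies in the trivialization domain, so the cut-off field is
  -- smooth on all of `M`.
  toFun u := ContMDiffSection.mk (⇑(bumpAt (E := E) x) • fun y => localConstField x y u) <|
    ContMDiffOn.smul_section_of_tsupport (bumpAt x).contMDiff.contMDiffOn
      (trivializationAt E (TangentSpace 𝓘(ℝ, E) : M → Type _) x).open_baseSet
      (bumpAt x).tsupport_subset_chartAt_source (contMDiffOn_localConstField u)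
  map_add' u v := by ext y; simp
  map_smul' c u := by ext y; simp [smul_comm c]

lemma extendField_eventually_eq {x : M} (u : TangentSpace 𝓘(ℝ, E) x) :
    ∀ᶠ y in nhds x, FiberBundle.extend E u y = extendField E x u y := by
  filter_upwards [(bumpAt (E := E) x).eventuallyEq_one,
    (trivializationAt E (TangentSpace 𝓘(ℝ, E) : M → Type _) x).open_baseSet.mem_nhds
      (FiberBundle.mem_baseSet_trivializationAt' x)] with y hy hy'
  change _ = bumpAt (E := E) x y • localConstField x y u
  rw [hy, localConstField_eq_extend u hy', Pi.one_apply, one_smul]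

@[simp] lemma extendField_self {x : M} (u : TangentSpace 𝓘(ℝ, E) x) :
    extendField E x u x = u := by
  rw [← (extendField_eventually_eq u).self_of_nhds, FiberBundle.extend_apply_self]

end Geometry
end AlmostHermitian

namespace AlmostHermitian

/-! ### Formal identities for connections on a module of fields. -/

section FieldAlgebra

variable {𝔛 T : Type*} [AddCommGroup 𝔛] [Module ℝ 𝔛] [AddCommGroup T] [Module ℝ T]

/-- The curvature `∇_{[U, V]} W - (∇_U ∇_V W - ∇_V ∇_U W)`, where `N` is the connection and `B` the
Lie bracket. -/
def curvatureMap (N B : 𝔛 →ₗ[ℝ] 𝔛 →ₗ[ℝ] 𝔛) : 𝔛 →ₗ[ℝ] 𝔛 →ₗ[ℝ] 𝔛 →ₗ[ℝ] 𝔛 :=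
  LinearMap.mk₂ ℝ (fun U V => N (B U V) - (N U ∘ₗ N V - N V ∘ₗ N U))
    (fun U V W => by ext Z; simp; abel) (fun c U V => by ext Z; simp [smul_sub])
    (fun U V W => by ext Z; simp; abel) (fun c U V => by ext Z; simp [smul_sub])

@[simp] lemma curvatureMap_apply (N B : 𝔛 →ₗ[ℝ] 𝔛 →ₗ[ℝ] 𝔛) (U V W : 𝔛) :
    curvatureMap N B U V W = N (B U V) W - (N U (N V W) - N V (N U W)) := rfl

/-- The covariant derivative `∇_U (S_V W) - S_{∇_U V} W - S_V (∇_U W)` of a tensor `S`. -/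
def covDerivMap (N S : 𝔛 →ₗ[ℝ] 𝔛 →ₗ[ℝ] 𝔛) : 𝔛 →ₗ[ℝ] 𝔛 →ₗ[ℝ] 𝔛 →ₗ[ℝ] 𝔛 :=
  LinearMap.mk₂ ℝ (fun U V => N U ∘ₗ S V - S (N U V) - S V ∘ₗ N U)
    (fun U V W => by ext Z; simp; abel) (fun c U V => by ext Z; simp [smul_sub])
    (fun U V W => by ext Z; simp; abel) (fun c U V => by ext Z; simp [smul_sub])

@[simp] lemma covDerivMap_apply (N S : 𝔛 →ₗ[ℝ] 𝔛 →ₗ[ℝ] 𝔛) (U V W : 𝔛) :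
    covDerivMap N S U V W = N U (S V W) - S (N U V) W - S V (N U W) := rfl

/-- The trilinear map on values induced by a trilinear map on fields and an extension map. -/
def restrictMap (ι : T →ₗ[ℝ] 𝔛) (ε : 𝔛 →ₗ[ℝ] T) (R : 𝔛 →ₗ[ℝ] 𝔛 →ₗ[ℝ] 𝔛 →ₗ[ℝ] 𝔛) :
    T →ₗ[ℝ] T →ₗ[ℝ] T →ₗ[ℝ] T :=
  LinearMap.mk₂ ℝ (fun u v => ε ∘ₗ R (ι u) (ι v) ∘ₗ ι)
    (fun u v w => by ext z; simp) (fun c u v => by ext z; simp)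
    (fun u v w => by ext z; simp) (fun c u v => by ext z; simp)

@[simp] lemma restrictMap_apply (ι : T →ₗ[ℝ] 𝔛) (ε : 𝔛 →ₗ[ℝ] T)
    (R : 𝔛 →ₗ[ℝ] 𝔛 →ₗ[ℝ] 𝔛 →ₗ[ℝ] 𝔛) (u v w : T) :
    restrictMap ι ε R u v w = ε (R (ι u) (ι v) (ι w)) := rfl

lemma curvatureMap_bianchi {N B : 𝔛 →ₗ[ℝ] 𝔛 →ₗ[ℝ] 𝔛} (hB : ∀ U V, B U V = N U V - N V U)
    (hJac : ∀ U V W, B U (B V W) = B (B U V) W + B V (B U W)) (U V W : 𝔛) :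
    curvatureMap N B U V W + curvatureMap N B V W U + curvatureMap N B W U V = 0 := by
  have h := hJac U V W
  simp only [curvatureMap_apply, hB, map_sub, LinearMap.sub_apply] at h ⊢
  linear_combination (norm := module) (-1 : ℝ) • h

/-- Only `B` being the torsion-free bracket of `N` is used; the terms `ξ_{ξ_U V}` appear because
`∇̃` has torsion. -/
lemma curvatureMap_eq {N Nt B : 𝔛 →ₗ[ℝ] 𝔛 →ₗ[ℝ] 𝔛} (hB : ∀ U V, B U V = N U V - N V U)
    (U V W : 𝔛) :
    curvatureMap N B U V W = curvatureMap Nt B U V W + covDerivMap Nt (Nt - N) U V W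
      - covDerivMap Nt (Nt - N) V U W - (Nt - N) U ((Nt - N) V W) + (Nt - N) V ((Nt - N) U W)
      + (Nt - N) ((Nt - N) U V) W - (Nt - N) ((Nt - N) V U) W := by
  simp only [curvatureMap_apply, covDerivMap_apply, hB, map_sub, LinearMap.sub_apply]
  abel

lemma curvatureMap_comm {N B : 𝔛 →ₗ[ℝ] 𝔛 →ₗ[ℝ] 𝔛} {J : 𝔛 →ₗ[ℝ] 𝔛}
    (hJ : ∀ U V, N U (J V) = J (N U V)) (U V W : 𝔛) :
    curvatureMap N B U V (J W) = J (curvatureMap N B U V W) := by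
  simp only [curvatureMap_apply, hJ, map_sub]

lemma covDerivMap_anticomm {N S : 𝔛 →ₗ[ℝ] 𝔛 →ₗ[ℝ] 𝔛} {J : 𝔛 →ₗ[ℝ] 𝔛}
    (hJ : ∀ U V, N U (J V) = J (N U V)) (hS : ∀ U V, S U (J V) = -J (S U V)) (U V W : 𝔛) :
    covDerivMap N S U V (J W) = -J (covDerivMap N S U V W) := by
  simp only [covDerivMap_apply, hJ, hS, map_sub, map_neg]
  abel

lemma covDerivMap_comp {N Nt : 𝔛 →ₗ[ℝ] 𝔛 →ₗ[ℝ] 𝔛} {J : 𝔛 →ₗ[ℝ] 𝔛}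
    (hJ : ∀ U V, Nt U (J V) = J (Nt U V)) (U V W : 𝔛) :
    covDerivMap N ((Nt - N).compr₂ J) U V W = J (covDerivMap Nt (Nt - N) U V W)
      - (Nt - N) U (J ((Nt - N) V W)) + J ((Nt - N) ((Nt - N) U V) W)
      + J ((Nt - N) V ((Nt - N) U W)) := by
  simp only [covDerivMap_apply, LinearMap.compr₂_apply, map_sub, LinearMap.sub_apply, hJ]
  abel

end FieldAlgebra

/-! ### The bracket as a commutator of derivations. -/

noncomputable section Curvature

variable {E : Type*} [NormedAddCommGroup E] [NormedSpace ℝ E]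
  {M : Type*} [TopologicalSpace M] [ChartedSpace E M] [IsManifold 𝓘(ℝ, E) ∞ M]

/-- The product of a smooth vector field with a smooth function. -/
def smulField (f : M → ℝ) (hf : CMDiff ∞ f) (W : SmoothField E M) : SmoothField E M :=
  ContMDiffSection.mk (f • ⇑W) (hf.smul_section W.contMDiff)

@[simp] lemma smulField_apply (f : M → ℝ) (hf : CMDiff ∞ f) (W : SmoothField E M) (y : M) :
    smulField f hf W y = f y • W y := rfl

variable [FiniteDimensional ℝ E]

lemma bracketMap_smulField {f : M → ℝ} (hf : CMDiff ∞ f) (V W : SmoothField E M)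
    (hfV : CMDiff ∞ (fun y => d% f y (V y))) :
    bracketMap V (smulField f hf W)
      = smulField _ hfV W + smulField f hf (bracketMap V W) := by
  have := FiniteDimensional.complete ℝ E
  ext y
  exact VectorField.mlieBracket_smul_right (hf.mdifferentiableAt (by simp)) W.mdifferentiableAt

variable [T2Space M]

/-- Expand the Jacobi identity for `U`, `V`, `f W` by the Leibniz rule and compare the coefficients
of `W`. The smoothness hypotheses keep every product a smooth field. -/
lemma mvfderiv_bracketMap {f : M → ℝ} (hf : CMDiff ∞ f) (U V : SmoothField E M)
    (hfU : CMDiff ∞ (fun y => d% f y (U y))) (hfV : CMDiff ∞ (fun y => d% f y (V y))) (x : M)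
    (hfB : CMDiff ∞ (fun y => d% f y (bracketMap U V y)))
    (hfUV : CMDiff ∞ (fun y => d% (fun z => d% f z (V z)) y (U y)))
    (hfVU : CMDiff ∞ (fun y => d% (fun z => d% f z (U z)) y (V y))) :
    d% f x (bracketMap U V x)
      = d% (fun z => d% f z (V z)) x (U x) - d% (fun z => d% f z (U z)) x (V x) := by
  have key : ∀ w : TangentSpace 𝓘(ℝ, E) x, (d% (fun z => d% f z (V z)) x (U x)
      - d% (fun z => d% f z (U z)) x (V x) - d% f x (bracketMap U V x)) • w = 0 := fun w => by
    have h := bracketMap_jacobi U V (smulField f hf (extendField E x w))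
    simp only [bracketMap_smulField hf _ _ hfU, bracketMap_smulField hf _ _ hfV,
      bracketMap_smulField hf _ _ hfB, map_add, bracketMap_smulField hfU _ _ hfVU,
      bracketMap_smulField hfV _ _ hfUV, bracketMap_jacobi U V (extendField E x w)] at h
    have hx := congrArg (SmoothField.eval x) h
    simp only [map_add, SmoothField.eval_apply, smulField_apply, ContMDiffSection.coe_add,
      Pi.add_apply, extendField_self, smul_add] at hx
    linear_combination (norm := module) hx
  -- If the tangent space is zero there is no vector to cancel, but both sides vanish.
  by_cases hw : ∃ w : TangentSpace 𝓘(ℝ, E) x, w ≠ 0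
  · obtain ⟨w, hw⟩ := hw
    linear_combination -((smul_eq_zero.1 (key w)).resolve_right hw)
  · push Not at hw
    rw [hw (bracketMap U V x), hw (U x), hw (V x)]
    simp

end Curvature
end AlmostHermitian

namespace AlmostHermitian

/-! ### Metric connections, skewness and tensoriality. -/

noncomputable section MetricConnection

variable {E : Type*} [NormedAddCommGroup E] [NormedSpace ℝ E]
  {M : Type*} [TopologicalSpace M] [ChartedSpace E M] [IsManifold 𝓘(ℝ, E) ∞ M]

/-- The metric at a point as a bilinear form. -/
def metricForm (g : ContMDiffRiemannianMetric 𝓘(ℝ, E) ∞ E (fun x : M => TangentSpace 𝓘(ℝ, E) x))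
    (x : M) : TangentSpace 𝓘(ℝ, E) x →ₗ[ℝ] TangentSpace 𝓘(ℝ, E) x →ₗ[ℝ] ℝ :=
  (ContinuousLinearMap.coeLM ℝ).comp (g.inner x).toLinearMap

variable {g : ContMDiffRiemannianMetric 𝓘(ℝ, E) ∞ E (fun x : M => TangentSpace 𝓘(ℝ, E) x)}

@[simp] lemma metricForm_apply (x : M) (u v : TangentSpace 𝓘(ℝ, E) x) :
    metricForm g x u v = g.inner x u v := rfl

lemma contMDiff_metric (W Z : SmoothField E M) :
    CMDiff ∞ (fun y => g.inner y (W y) (Z y)) := by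
  have h : ContMDiff 𝓘(ℝ, E) (𝓘(ℝ, E).prod 𝓘(ℝ, ℝ)) ∞
      (fun y => TotalSpace.mk' ℝ (E := Bundle.Trivial M ℝ) y (g.inner y (W y) (Z y))) :=
    g.contMDiff.clm_bundle_apply₂ W.contMDiff Z.contMDiff
  exact fun y => (contMDiffAt_section _).1 (h y)

lemma eq_of_forall_metric_eq {x : M} {u v : TangentSpace 𝓘(ℝ, E) x}
    (h : ∀ z, g.inner x u z = g.inner x v z) : u = v := by
  by_contra hne
  refine (g.pos x (u - v) (sub_ne_zero.2 hne)).ne' ?_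
  rw [(g.inner x).map_sub, sub_apply, h, sub_self]

section

variable {D : CovariantDerivative 𝓘(ℝ, E) E (TangentSpace 𝓘(ℝ, E) : M → Type _)}
  (hD : D.ContMDiffCovariantDerivative ∞)

include hD in
lemma IsMetric.mvfderiv_eq (hg : IsMetric g D) (U W Z : SmoothField E M) :
    (fun y => d% (fun z => g.inner z (W z) (Z z)) y (U y))
      = fun y => g.inner y (connectionMap D hD U W y) (Z y)
        + g.inner y (W y) (connectionMap D hD U Z y) :=
  funext fun y => hg y W Z (U y) W.mdifferentiableAt Z.mdifferentiableAt

lemma IsMetric.covDerivMap_skew (hg : IsMetric g D)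
    {S : SmoothField E M →ₗ[ℝ] SmoothField E M →ₗ[ℝ] SmoothField E M}
    (hS : ∀ V W Z x, g.inner x (S V W x) (Z x) = -g.inner x (W x) (S V Z x))
    (U V W Z : SmoothField E M) (x : M) :
    g.inner x (covDerivMap (connectionMap D hD) S U V W x) (Z x)
      = -g.inner x (W x) (covDerivMap (connectionMap D hD) S U V Z x) := by
  have h1 := congrFun (hg.mvfderiv_eq hD U (S V W) Z) x
  have h2 := congrFun (hg.mvfderiv_eq hD U W (S V Z)) x
  have h3 : (fun z => g.inner z (S V W z) (Z z)) = -fun z => g.inner z (W z) (S V Z z) :=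
    funext fun z => hS V W Z z
  simp only [h3, mvfderiv_neg, neg_apply] at h1
  simp only [covDerivMap_apply, ContMDiffSection.coe_sub, Pi.sub_apply, map_sub,
    sub_apply, hS]
  linarith [hS V (connectionMap D hD U W) Z x, hS V W (connectionMap D hD U Z) x]

variable [FiniteDimensional ℝ E] [T2Space M]

/-- Differentiate `⟨W, Z⟩` along `U`, `V` and `[U, V]`; the mixed terms `⟨∇_U W, ∇_V Z⟩` cancel in
the commutator. -/
lemma IsMetric.curvatureMap_skew (hg : IsMetric g D) (U V W Z : SmoothField E M) (x : M) :
    g.inner x (curvatureMap (connectionMap D hD) bracketMap U V W x) (Z x)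
      = -g.inner x (W x) (curvatureMap (connectionMap D hD) bracketMap U V Z x) := by
  have hs : ∀ U W Z : SmoothField E M,
      CMDiff ∞ (fun y => d% (fun z => g.inner z (W z) (Z z)) y (U y)) := fun U W Z => by
    rw [hg.mvfderiv_eq hD]
    exact (contMDiff_metric _ _).add (contMDiff_metric _ _)
  have hd : ∀ U V W Z : SmoothField E M,
      (fun y => d% (fun z => d% (fun z => g.inner z (W z) (Z z)) z (V z)) y (U y))
        = fun y => d% (fun z => g.inner z (connectionMap D hD V W z) (Z z)) y (U y)
          + d% (fun z => g.inner z (W z) (connectionMap D hD V Z z)) y (U y) :=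
    fun U V W Z => by
      rw [hg.mvfderiv_eq hD V]
      funext y
      rw [mvfderiv_fun_add ((contMDiff_metric _ _).mdifferentiableAt (by simp))
        ((contMDiff_metric _ _).mdifferentiableAt (by simp)), add_apply]
  have hs2 : ∀ U V W Z : SmoothField E M,
      CMDiff ∞ (fun y => d% (fun z => d% (fun z => g.inner z (W z) (Z z)) z (V z)) y (U y)) :=
    fun U V W Z => by
      rw [hd]
      exact (hs _ _ _).add (hs _ _ _)
  have h := mvfderiv_bracketMap (contMDiff_metric (g := g) W Z) U V (hs U W Z) (hs V W Z) x
    (hs _ W Z) (hs2 U V W Z) (hs2 V U W Z)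
  have e1 := congrFun (hd U V W Z) x
  have e2 := congrFun (hd V U W Z) x
  have e3 := congrFun (hg.mvfderiv_eq hD (bracketMap U V) W Z) x
  have e4 := congrFun (hg.mvfderiv_eq hD U (connectionMap D hD V W) Z) x
  have e5 := congrFun (hg.mvfderiv_eq hD U W (connectionMap D hD V Z)) x
  have e6 := congrFun (hg.mvfderiv_eq hD V (connectionMap D hD U W) Z) x
  have e7 := congrFun (hg.mvfderiv_eq hD V W (connectionMap D hD U Z)) x
  simp only [curvatureMap_apply, ContMDiffSection.coe_sub, Pi.sub_apply, map_sub,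
    sub_apply]
  linarith

end

/-- A skew operator on vector fields is tensorial. -/
lemma eq_of_skew_of_eq [FiniteDimensional ℝ E] [T2Space M]
    {P : SmoothField E M → SmoothField E M} {x : M}
    (hP : ∀ W Z, g.inner x (P W x) (Z x) = -g.inner x (W x) (P Z x))
    {W W' : SmoothField E M} (h : W x = W' x) : P W x = P W' x :=
  eq_of_forall_metric_eq (g := g) fun z => by
    rw [← extendField_self (E := E) z, hP, hP, h]

section

variable (D : CovariantDerivative 𝓘(ℝ, E) E (TangentSpace 𝓘(ℝ, E) : M → Type _))
  (hD : D.ContMDiffCovariantDerivative ∞)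

lemma covariantDerivative_congr {x : M} {σ : ∀ y : M, TangentSpace 𝓘(ℝ, E) y}
    {W : SmoothField E M} (h : ∀ᶠ y in nhds x, σ y = W y) : D σ x = D W x := by
  refine D.isCovariantDerivativeOn.congr_of_eventuallyEq (s := Set.univ) ?_ W.mdifferentiableAt
    Filter.univ_mem h
  exact W.mdifferentiableAt.congr_of_eventuallyEq (h.mono fun y hy => by simp only [hy])

variable [FiniteDimensional ℝ E] [T2Space M]

/-- The two extensions agree near `x` and every operator involved is local. -/
lemma curvature_eq_restrictMap (x : M) (u v w : TangentSpace 𝓘(ℝ, E) x) :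
    curvature D x u v w = restrictMap (extendField E x) (SmoothField.eval x)
      (curvatureMap (connectionMap D hD) bracketMap) u v w := by
  have hD' : ∀ u v : TangentSpace 𝓘(ℝ, E) x,
      ∀ᶠ y in nhds x, D (FiberBundle.extend E v) y (FiberBundle.extend E u y)
        = connectionMap D hD (extendField E x u) (extendField E x v) y := fun u v => by
    filter_upwards [(extendField_eventually_eq v).eventually_nhds,
      extendField_eventually_eq u] with y hv hu
    rw [covariantDerivative_congr D hv, hu, connectionMap_apply]
  rw [curvature, curvatureField, covariantDerivative_congr D (hD' v w),
    covariantDerivative_congr D (hD' u w),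
    covariantDerivative_congr D (extendField_eventually_eq w),
    Filter.EventuallyEq.mlieBracket_vectorField_eq (extendField_eventually_eq u)
      (extendField_eventually_eq v), (extendField_eventually_eq u).self_of_nhds,
    (extendField_eventually_eq v).self_of_nhds]
  rfl

lemma covDerivTensor_eq_restrictMap
    {T : ∀ x : M, TangentSpace 𝓘(ℝ, E) x →ₗ[ℝ] TangentSpace 𝓘(ℝ, E) x →ₗ[ℝ]
      TangentSpace 𝓘(ℝ, E) x}
    {S : SmoothField E M →ₗ[ℝ] SmoothField E M →ₗ[ℝ] SmoothField E M}
    (hS : ∀ U V y, S U V y = T y (U y) (V y)) (x : M) (u v w : TangentSpace 𝓘(ℝ, E) x) :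
    covDerivTensor D T x u v w = restrictMap (extendField E x) (SmoothField.eval x)
      (covDerivMap (connectionMap D hD) S) u v w := by
  have h : ∀ᶠ y in nhds x, T y (FiberBundle.extend E v y) (FiberBundle.extend E w y)
      = S (extendField E x v) (extendField E x w) y := by
    filter_upwards [extendField_eventually_eq v, extendField_eventually_eq w] with y hv hw
    rw [hS, hv, hw]
  rw [covDerivTensor, covariantDerivative_congr D h,
    covariantDerivative_congr D (extendField_eventually_eq v),
    covariantDerivative_congr D (extendField_eventually_eq w)]
  simp [hS]

end

end MetricConnection
end AlmostHermitian

namespace AlmostHermitian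

/-! ### The intrinsic torsion and its curvature relations. -/

noncomputable section IntrinsicTorsion

variable {E : Type*} [NormedAddCommGroup E] [NormedSpace ℝ E]
  {M : Type*} [TopologicalSpace M] [ChartedSpace E M] [IsManifold 𝓘(ℝ, E) ∞ M]
  {g : ContMDiffRiemannianMetric 𝓘(ℝ, E) ∞ E (fun x : M => TangentSpace 𝓘(ℝ, E) x)}
  {J : ∀ x : M, TangentSpace 𝓘(ℝ, E) x →L[ℝ] TangentSpace 𝓘(ℝ, E) x}

/-- The action of the almost complex structure on smooth vector fields. -/
def complexMap (hJ : IsAlmostHermitian g J) : SmoothField E M →ₗ[ℝ] SmoothField E M where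
  toFun W := ContMDiffSection.mk (fun y => J y (W y)) (hJ.smooth.clm_bundle_apply W.contMDiff)
  map_add' U V := by ext y; exact (J y).map_add _ _
  map_smul' c U := by ext y; exact (J y).map_smul _ _

@[simp] lemma complexMap_apply (hJ : IsAlmostHermitian g J) (W : SmoothField E M) (y : M) :
    complexMap hJ W y = J y (W y) := rfl

lemma IsAlmostHermitian.skew (hJ : IsAlmostHermitian g J) (x : M)
    (u v : TangentSpace 𝓘(ℝ, E) x) : g.inner x (J x u) v = -g.inner x u (J x v) := by
  rw [← hJ.orthogonal x u (J x v), hJ.sq, map_neg, neg_neg]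

variable [FiniteDimensional ℝ E]
  {D Dt : CovariantDerivative 𝓘(ℝ, E) E (TangentSpace 𝓘(ℝ, E) : M → Type _)}

lemma differenceTensor_apply (x : M) (u : TangentSpace 𝓘(ℝ, E) x) (W : SmoothField E M) :
    differenceTensor D Dt x u (W x) = Dt W x u - D W x u := by
  have h : Dt.difference D x (W x) = Dt W x - D W x :=
    IsCovariantDerivativeOn.difference_apply _ _ (Set.mem_univ x) W.mdifferentiableAt
  exact congrArg (fun A => A u) h

lemma connectionMap_sub_apply (hD : D.ContMDiffCovariantDerivative ∞)
    (hDt : Dt.ContMDiffCovariantDerivative ∞) (U W : SmoothField E M) (x : M) :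
    (connectionMap Dt hDt - connectionMap D hD) U W x
      = differenceTensor D Dt x (U x) (W x) :=
  (differenceTensor_apply x (U x) W).symm

lemma differenceTensor_anticomm (hJ : IsAlmostHermitian g J) (hDt : IsMinimalUnitary g J D Dt)
    (x : M) (u v : TangentSpace 𝓘(ℝ, E) x) :
    differenceTensor D Dt x u (J x v) = -J x (differenceTensor D Dt x u v) := by
  have : FiniteDimensional ℝ (TangentSpace 𝓘(ℝ, E) x) := inferInstanceAs (FiniteDimensional ℝ E)
  exact apply_complex_eq_neg_of_trace (g := metricForm g x) (J := (J x).toLinearMap)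
    (g.symm x) (g.pos x) (hJ.sq x) (hJ.skew x) (hDt.perp x u).1 (hDt.perp x u).2 v

lemma IsLeviCivita.bracketMap_eq (hD : IsLeviCivita g D) (U V : SmoothField E M) :
    bracketMap U V = connectionMap D hD.smooth U V - connectionMap D hD.smooth V U := by
  have := FiniteDimensional.complete ℝ E
  have : IsManifold 𝓘(ℝ, E) 2 M := .of_le (n := ∞)
    (by simpa using minSmoothness_two_le_infty)
  ext y
  exact (D.torsion_eq_zero_iff.1 hD.torsion_free U.mdifferentiableAt V.mdifferentiableAt).symm

lemma IsMinimalUnitary.connectionMap_complexMap (hJ : IsAlmostHermitian g J)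
    (hDt : IsMinimalUnitary g J D Dt) (U V : SmoothField E M) :
    connectionMap Dt hDt.smooth U (complexMap hJ V)
      = complexMap hJ (connectionMap Dt hDt.smooth U V) := by
  ext y
  exact hDt.parallel y V (U y) V.mdifferentiableAt

variable [T2Space M]

lemma torsionCurvatureData (hJ : IsAlmostHermitian g J) (hD : IsLeviCivita g D)
    (hDt : IsMinimalUnitary g J D Dt) (x : M) :
    TorsionCurvatureData (metricForm g x) (J x).toLinearMap
      (restrictMap (extendField E x) (SmoothField.eval x)
        (curvatureMap (connectionMap D hD.smooth) bracketMap))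
      (restrictMap (extendField E x) (SmoothField.eval x)
        (curvatureMap (connectionMap Dt hDt.smooth) bracketMap))
      (restrictMap (extendField E x) (SmoothField.eval x)
        (covDerivMap (connectionMap Dt hDt.smooth)
          (connectionMap Dt hDt.smooth - connectionMap D hD.smooth)))
      (differenceTensor D Dt x) := by
  have hξ := connectionMap_sub_apply hD.smooth hDt.smooth
  have hξJ : ∀ U V, (connectionMap Dt hDt.smooth - connectionMap D hD.smooth) U (complexMap hJ V)
      = -complexMap hJ ((connectionMap Dt hDt.smooth - connectionMap D hD.smooth) U V) :=
    fun U V => by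
      ext y
      rw [hξ]
      exact (differenceTensor_anticomm hJ hDt y _ _).trans (by rw [← hξ]; rfl)
  have hξs : ∀ V W Z y,
      g.inner y ((connectionMap Dt hDt.smooth - connectionMap D hD.smooth) V W y) (Z y)
        = -g.inner y (W y) ((connectionMap Dt hDt.smooth - connectionMap D hD.smooth) V Z y) :=
    fun V W Z y => by
      rw [hξ, hξ]
      exact (hDt.perp y (V y)).1 (W y) (Z y)
  have hJx : ∀ w : TangentSpace 𝓘(ℝ, E) x,
      extendField E x (J x w) x = complexMap hJ (extendField E x w) x := fun w => by simp
  refine ⟨g.symm x, hJ.sq x, hJ.orthogonal x, ?_, ?_, ?_, ?_, ?_, ?_,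
    differenceTensor_anticomm hJ hDt x⟩
  · intro u v w
    simp only [restrictMap_apply, curvatureMap_apply, bracketMap_swap (extendField E x u),
      map_neg, map_sub, LinearMap.neg_apply]
    abel
  · intro u v w z
    simpa using hD.metric.curvatureMap_skew hD.smooth (extendField E x u) (extendField E x v)
      (extendField E x w) (extendField E x z) x
  · intro u v w
    simp only [restrictMap_apply, ← map_add]
    rw [curvatureMap_bianchi hD.bracketMap_eq bracketMap_jacobi, map_zero]
  · intro u v w
    simp only [restrictMap_apply]
    rw [curvatureMap_eq (Nt := connectionMap Dt hDt.smooth) hD.bracketMap_eq]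
    simp only [map_add, map_sub, SmoothField.eval_apply, hξ, extendField_self]
  · intro u v w
    -- Extending `J w` and applying `J` to the extension of `w` give fields that need only agree at
    -- `x`; skewness makes the last slot tensorial, so this suffices.
    have h := eq_of_skew_of_eq (g := g)
      (hDt.metric.curvatureMap_skew hDt.smooth (extendField E x u) (extendField E x v) · · x)
      (hJx w)
    rw [curvatureMap_comm (hDt.connectionMap_complexMap hJ)] at h
    exact h
  · intro u v w
    have h := eq_of_skew_of_eq (g := g)
      (hDt.metric.covDerivMap_skew hDt.smooth hξs (extendField E x u) (extendField E x v) · · x)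
      (hJx w)
    rw [covDerivMap_anticomm (hDt.connectionMap_complexMap hJ) hξJ] at h
    exact h

lemma covDerivTensor_compTensor (hJ : IsAlmostHermitian g J) (hD : IsLeviCivita g D)
    (hDt : IsMinimalUnitary g J D Dt) (x : M) (u v w : TangentSpace 𝓘(ℝ, E) x) :
    covDerivTensor D (compTensor J (differenceTensor D Dt)) x u v w
      = J x (covDerivTensor Dt (differenceTensor D Dt) x u v w)
        - differenceTensor D Dt x u (J x (differenceTensor D Dt x v w))
        + J x (differenceTensor D Dt x (differenceTensor D Dt x u v) w)
        + J x (differenceTensor D Dt x v (differenceTensor D Dt x u w)) := by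
  have hξ := connectionMap_sub_apply hD.smooth hDt.smooth
  rw [covDerivTensor_eq_restrictMap Dt hDt.smooth hξ,
    covDerivTensor_eq_restrictMap D hD.smooth (T := compTensor J (differenceTensor D Dt))
      (S := (connectionMap Dt hDt.smooth - connectionMap D hD.smooth).compr₂ (complexMap hJ))
      (fun U V y => congrArg (J y) (hξ U V y))]
  simp only [restrictMap_apply]
  rw [covDerivMap_comp (hDt.connectionMap_complexMap hJ)]
  simp only [map_add, map_sub, SmoothField.eval_apply, hξ, extendField_self, complexMap_apply]

end IntrinsicTorsion
end AlmostHermitian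

theorem lemma3p7 {E : Type*} [NormedAddCommGroup E] [NormedSpace ℝ E] [FiniteDimensional ℝ E]
    (n : ℕ) (hE : Module.finrank ℝ E = 2 * n)
    {M : Type*} [TopologicalSpace M] [T2Space M] [ChartedSpace E M] [IsManifold 𝓘(ℝ, E) ∞ M]
    (g : ContMDiffRiemannianMetric 𝓘(ℝ, E) ∞ E (fun x : M => TangentSpace 𝓘(ℝ, E) x))
    (J : ∀ x : M, TangentSpace 𝓘(ℝ, E) x →L[ℝ] TangentSpace 𝓘(ℝ, E) x)
    (hJ : IsAlmostHermitian g J)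
    (D Dt : CovariantDerivative 𝓘(ℝ, E) E (TangentSpace 𝓘(ℝ, E) : M → Type _))
    (hD : IsLeviCivita g D) (hDt : IsMinimalUnitary g J D Dt)
    (ξ : ∀ x : M, TangentSpace 𝓘(ℝ, E) x →ₗ[ℝ] TangentSpace 𝓘(ℝ, E) x →ₗ[ℝ]
      TangentSpace 𝓘(ℝ, E) x)
    (hξ : ξ = differenceTensor D Dt)
    (x : M) (e : Module.Basis (Fin (2 * n)) ℝ (TangentSpace 𝓘(ℝ, E) x))
    (he : IsOrthonormalBasis g e) (X Y : TangentSpace 𝓘(ℝ, E) x) :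
    antiHermitianPart J (starRicci g J D e) X Y
        = ∑ i, g.inner x (covDerivTensor Dt ξ x (e i) (J x (e i)) (J x X)) Y
          - ∑ i, g.inner x (ξ x (J x (ξ x (e i) (e i))) (J x X)) Y ∧
    antiHermitianPart J (starRicci g J D e) X Y
        = -∑ i, g.inner x (covDerivTensor D (compTensor J ξ) x (e i) (J x (e i)) X) Y := by
  subst hξ
  have h := torsionCurvatureData hJ hD hDt x
  have h1 := h.half_sub_starRicci he X Y
  have h2 := h.sum_deriv_complex_torsion he X Y
  have hC := covDerivTensor_eq_restrictMap Dt hDt.smooth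
    (connectionMap_sub_apply hD.smooth hDt.smooth) x
  have hR := curvature_eq_restrictMap D hD.smooth x
  have h3 : antiHermitianPart J (starRicci g J D e) X Y
      = ∑ i, g.inner x (covDerivTensor Dt (differenceTensor D Dt) x (e i) (J x (e i)) (J x X)) Y
        - ∑ i, g.inner x (differenceTensor D Dt x (J x (differenceTensor D Dt x (e i) (e i)))
          (J x X)) Y := by
    simp only [antiHermitianPart, starRicci, hC, hR]
    exact h1
  refine ⟨h3, h3.trans ?_⟩
  simp only [covDerivTensor_compTensor hJ hD hDt, hC]
  exact h2
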